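/- Let $\mathcal V$ be a variety of (finitary, single-sorted) algebras, given by a set of operations of finite arity and a set of identities; morphisms of $\mathcal V$ are the maps that preserve the operations. Call $\mathcal V$ *commutative* if every operation lifts to a morphism in $\mathcal V$: for every algebra $A$ in $\mathcal V$ and every (derived) $n$-ary operation $\omega$, the map $\omega_A\colon A^n\to A$ is a morphism of algebras, where $A^n$ carries the coordinatewise operations. Let $\mathcal V$ be a commutative variety of algebras, and let $F_{\mathcal V}\colon \mathbf{Set}\to\mathcal V$ be the free functor, i.e. the left adjoint of the forgetful functor. Equip $\mathcal V$ with Linton's symmetric monoidal structure $(\mathcal V,\otimes,F_{\mathcal V}(\{*\}))$: the tensor product $A\otimes B$ is the algebra with a universal map $A\times B\to A\otimes B$, $(a,b)\mapsto a\otimes b$, that is a morphism of algebras in each variable separately, the unit is the free algebra on a one-element set, and the structure isomorphisms are the canonical ones, given by $(a\otimes b)\otimes c\mapsto a\otimes(b\otimes c)$, $*\otimes a\mapsto a$, $a\otimes *\mapsto a$ and $a\otimes b\mapsto b\otimes a$. Then the functor $$F_{\mathcal V}\colon(\mathbf{Set},\times,\{*\})\to(\mathcal V,\otimes,F_{\mathcal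 V}(\{*\}))$$ is strong symmetric monoidal: it carries a strong monoidal structure, consisting of an isomorphism $F_{\mathcal V}(\{*\})\cong F_{\mathcal V}(\{*\})$ of units and isomorphisms $F_{\mathcal V}(S)\otimes F_{\mathcal V}(T)\cong F_{\mathcal V}(S\times T)$, natural in the sets $S$ and $T$, that satisfy the associativity and unit coherence conditions and are compatible with the symmetries. -/

import Mathlib

open CategoryTheory FirstOrder FirstOrder.Language MonoidalCategory

universe u

/-- A finitary variety of algebras, given by operations and identities: a language without relation
symbols (the primary operations, each with a finite arity), and a set of pairs of terms in countably
many variables (the identities). -/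
structure AlgVariety where
  /-- the primary operations -/
  lang : FirstOrder.Language.{u, 0}
  /-- there are no relation symbols -/
  isAlgebraic : lang.IsAlgebraic
  /-- the identities -/
  identities : Set (lang.Term ℕ × lang.Term ℕ)

namespace AlgVariety

open Structure

attribute [instance] AlgVariety.isAlgebraic

/-- An object of the variety: a set with operations that satisfy the identities. -/
structure Alg (V : AlgVariety.{u}) where
  /-- the underlying set -/
  carrier : Type u
  /-- the operations -/
  [str : V.lang.Structure carrier]
  /-- the identities hold -/
  sat : ∀ e ∈ V.identities, ∀ v : ℕ → carrier, e.1.realize v = e.2.realize v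

variable {V : AlgVariety.{u}}

instance : CoeSort V.Alg (Type u) := ⟨Alg.carrier⟩

attribute [coe] Alg.carrier

instance (A : V.Alg) : V.lang.Structure A := A.str

/-- The category of algebras of the variety; morphisms are the maps that preserve the operations. -/
instance : Category.{u} V.Alg where
  Hom A B := A →[V.lang] B
  id A := Hom.id V.lang A
  comp f g := Hom.comp g f

instance : ConcreteCategory V.Alg (fun A B => A →[V.lang] B) where
  hom f := f
  ofHom f := f

/-- A map that preserves the operations, as a morphism. -/
def homMk {A B : V.Alg} (g : A → B)
    (h : ∀ {n} (f : V.lang.Functions n) (x : Fin n → A),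
      g (funMap f x) = funMap f (fun i => g (x i))) : A ⟶ B :=
  ConcreteCategory.ofHom (C := V.Alg)
    { toFun := g
      map_fun' := h
      map_rel' := fun {n} r => (V.isAlgebraic n).elim r }

@[simp] lemma homMk_apply {A B : V.Alg} (g : A → B) (h) (a : A) :
    (homMk (A := A) (B := B) g h) a = g a := rfl

lemma map_op {A B : V.Alg} (g : A ⟶ B) {n : ℕ} (f : V.lang.Functions n) (x : Fin n → A) :
    g (funMap f x) = funMap f (fun i => g (x i)) :=
  Hom.map_fun' g f x

lemma map_term {A B : V.Alg} (g : A ⟶ B) {α : Type*} (t : V.lang.Term α) (x : α → A) :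
    g (t.realize x) = t.realize (fun i => g (x i)) :=
  (HomClass.realize_term (L := V.lang) (show A →[V.lang] B from g) (t := t) (v := x)).symm

lemma alg_hom_ext {A B : V.Alg} {f g : A ⟶ B} (h : ∀ a : A, f a = g a) : f = g :=
  ConcreteCategory.hom_ext _ _ h

/-! ### Powers and commutativity -/

instance powStructure (A : V.Alg) (n : ℕ) : V.lang.Structure (Fin n → A) where
  funMap f x := fun i => funMap f (fun j => x j i)
  RelMap := fun {n} r => (V.isAlgebraic n).elim r

lemma pow_realize (A : V.Alg) (n : ℕ) {α : Type*} (t : V.lang.Term α) (x : α → Fin n → A)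
    (i : Fin n) : t.realize x i = t.realize (fun a => x a i) := by
  induction t with
  | var => rfl
  | func f ts ih =>
    simp only [Term.realize_func]
    change funMap f (fun j => (ts j).realize x i) = _
    simp only [ih]

/-- The `n`-fold power of an algebra in the variety; operations act coordinatewise. -/
def pow (A : V.Alg) (n : ℕ) : V.Alg where
  carrier := Fin n → A
  sat e he v := by
    funext i
    rw [pow_realize, pow_realize]
    exact A.sat e he _

/-- A variety is commutative if every operation of the theory lifts to a morphism in the variety:
for each algebra `A` and each (derived) `n`-ary operation, i.e. each term in `n` variables, the map
`Aⁿ → A` that it defines underlies a morphism of algebras. -/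
class IsCommutative (V : AlgVariety.{u}) : Prop where
  lift_op : ∀ (A : V.Alg) (n : ℕ) (t : V.lang.Term (Fin n)),
    ∃ φ : pow A n ⟶ A, ∀ x : Fin n → A, φ x = t.realize x

lemma op_comm [V.IsCommutative] (A : V.Alg) {n m : ℕ} (f : V.lang.Functions n)
    (g : V.lang.Functions m) (x : Fin n → Fin m → A) :
    funMap f (fun i => funMap g (x i)) = funMap g (fun j => funMap f (fun i => x i j)) := by
  obtain ⟨φ, hφ⟩ := IsCommutative.lift_op A n (Term.func f Term.var)
  have h := map_op φ g (fun j i => x i j)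
  have h1 := hφ (fun i => funMap g (x i))
  have h2 : ∀ j, φ (fun i => x i j) = funMap f (fun i => x i j) := fun j => hφ _
  exact h1.symm.trans (h.trans (congrArg _ (funext h2)))

/-! ### Algebras presented by generators and relations -/

/-- The least congruence on terms over `X` that contains the relation `R` and all instances of the
identities of the variety. -/
inductive Cong (V : AlgVariety.{u}) {X : Type u} (R : V.lang.Term X → V.lang.Term X → Prop) :
    V.lang.Term X → V.lang.Term X → Prop
  | rel {s t} : R s t → Cong V R s t
  | ident {e} (he : e ∈ V.identities) (σ : ℕ → V.lang.Term X) :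
      Cong V R (e.1.subst σ) (e.2.subst σ)
  | op {n} (f : V.lang.Functions n) {s t : Fin n → V.lang.Term X} :
      (∀ i, Cong V R (s i) (t i)) → Cong V R (Term.func f s) (Term.func f t)
  | refl (t) : Cong V R t t
  | symm {s t} : Cong V R s t → Cong V R t s
  | trans {s t r} : Cong V R s t → Cong V R t r → Cong V R s r

/-- The setoid of the congruence `Cong`. -/
def congSetoid {X : Type u} (R : V.lang.Term X → V.lang.Term X → Prop) :
    Setoid (V.lang.Term X) :=
  ⟨Cong V R, ⟨Cong.refl, Cong.symm, Cong.trans⟩⟩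

noncomputable instance quotStructure {X : Type u} (R : V.lang.Term X → V.lang.Term X → Prop) :
    V.lang.Structure (Quotient (congSetoid R)) where
  funMap f x := Quotient.mk _ (Term.func f (fun i => (x i).out))
  RelMap := fun {n} r => (V.isAlgebraic n).elim r

lemma quot_op {X : Type u} (R : V.lang.Term X → V.lang.Term X → Prop) {n : ℕ}
    (f : V.lang.Functions n) (ts : Fin n → V.lang.Term X) :
    funMap f (fun i => Quotient.mk (congSetoid R) (ts i)) =
      Quotient.mk (congSetoid R) (Term.func f ts) :=
  Quotient.sound (Cong.op f fun i => Quotient.mk_out (s := congSetoid R) (ts i))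

lemma quot_realize {X : Type u} (R : V.lang.Term X → V.lang.Term X → Prop) {α : Type*}
    (t : V.lang.Term α) (σ : α → V.lang.Term X) :
    t.realize (fun a => Quotient.mk (congSetoid R) (σ a)) =
      Quotient.mk (congSetoid R) (t.subst σ) := by
  induction t with
  | var => rfl
  | func f ts ih =>
    simp only [Term.realize_func, ih, quot_op]
    rfl

/-- The algebra of the variety with generators `X` and relations `R`. -/
noncomputable def presented {X : Type u} (R : V.lang.Term X → V.lang.Term X → Prop) : V.Alg where
  carrier := Quotient (congSetoid R)
  sat e he v := by
    have hv : v = fun a => Quotient.mk (congSetoid R) ((v a).out) :=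
      funext fun a => (Quotient.out_eq _).symm
    rw [hv, quot_realize, quot_realize]
    exact Quotient.sound (Cong.ident he _)

namespace presented

variable {X : Type u} {R : V.lang.Term X → V.lang.Term X → Prop}

/-- The generator of the presented algebra with name `x`. -/
def gen (x : X) : presented R := Quotient.mk (congSetoid R) (Term.var x)

lemma realize_gen (t : V.lang.Term X) :
    t.realize (gen (R := R)) = Quotient.mk (congSetoid R) t := by
  refine (quot_realize R t Term.var).trans (congrArg _ ?_)
  induction t with
  | var => rfl
  | func f ts ih => exact congrArg _ (funext ih)

lemma rel_gen {s t : V.lang.Term X} (h : R s t) :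
    s.realize (gen (R := R)) = t.realize (gen (R := R)) := by
  rw [realize_gen, realize_gen]
  exact Quotient.sound (Cong.rel h)

lemma realize_eq_of_cong {C : V.Alg} (φ : X → C)
    (h : ∀ s t, R s t → s.realize φ = t.realize φ) {s t : V.lang.Term X} (hst : Cong V R s t) :
    s.realize φ = t.realize φ := by
  induction hst with
  | rel h' => exact h _ _ h'
  | ident he σ =>
    rw [Term.realize_subst, Term.realize_subst]
    exact C.sat _ he _
  | op f _ ih => simp only [Term.realize_func, ih]
  | refl => rfl
  | symm _ ih => exact ih.symm
  | trans _ _ ih1 ih2 => exact ih1.trans ih2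

/-- The morphism out of a presented algebra given by images of the generators that satisfy the
relations. -/
noncomputable def desc {C : V.Alg} (φ : X → C) (h : ∀ s t, R s t → s.realize φ = t.realize φ) :
    presented R ⟶ C :=
  homMk (Quotient.lift (s := congSetoid R) (fun t => t.realize φ)
    fun _ _ hst => realize_eq_of_cong φ h hst) fun {n} f x => by
      have hx : x = fun a => Quotient.mk (congSetoid R) ((x a).out) :=
        funext fun a => (Quotient.out_eq _).symm
      rw [hx]
      erw [quot_op]
      rfl

@[simp] lemma desc_gen {C : V.Alg} (φ : X → C) (h) (x : X) : desc (R := R) φ h (gen x) = φ x := rfl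

lemma hom_ext {C : V.Alg} {f g : presented R ⟶ C} (h : ∀ x, f (gen x) = g (gen x)) : f = g := by
  refine alg_hom_ext fun a => ?_
  induction a using Quotient.inductionOn with
  | _ t =>
    have e := realize_gen (R := R) t
    rw [← e, map_term, map_term]
    exact congrArg (fun v => t.realize v) (funext h)

end presented

/-! ### The free functor -/

/-- The free algebra on a set. -/
noncomputable def freeObj (V : AlgVariety.{u}) (S : Type u) : V.Alg :=
  presented (fun (_ _ : V.lang.Term S) => False)

/-- The generators of the free algebra. -/
def freeι {S : Type u} (s : S) : freeObj V S := presented.gen s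

/-- The morphism out of a free algebra given by a map on generators. -/
noncomputable def freeDesc {S : Type u} {A : V.Alg} (φ : S → A) : freeObj V S ⟶ A :=
  presented.desc φ (fun _ _ h => h.elim)

@[simp] lemma freeDesc_ι {S : Type u} {A : V.Alg} (φ : S → A) (s : S) :
    freeDesc φ (freeι s) = φ s := rfl

lemma free_ext {S : Type u} {A : V.Alg} {f g : freeObj V S ⟶ A}
    (h : ∀ s, f (freeι s) = g (freeι s)) : f = g := presented.hom_ext h

/-- The free functor from sets to the variety. -/
noncomputable def free (V : AlgVariety.{u}) : Type u ⥤ V.Alg where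
  obj S := freeObj V S
  map φ := freeDesc (fun s => freeι (φ s))
  map_id _ := free_ext fun _ => rfl
  map_comp _ _ := free_ext fun _ => rfl

/-- The free functor is left adjoint to the forgetful functor. -/
noncomputable def freeAdj (V : AlgVariety.{u}) : free V ⊣ forget V.Alg :=
  Adjunction.mkOfHomEquiv
    { homEquiv := fun _ _ =>
        { toFun := fun g => ↾(fun s => g (freeι s))
          invFun := fun φ => freeDesc (fun s => φ s)
          left_inv := fun _ => free_ext fun _ => rfl
          right_inv := fun _ => rfl }
      homEquiv_naturality_left_symm := fun _ _ => free_ext fun _ => rfl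
      homEquiv_naturality_right := fun _ _ => rfl }

/-! ### The tensor product -/

/-- Bihomomorphisms `A × B → C`: maps that are a morphism in each variable separately. -/
@[ext]
structure BiHom (A B C : V.Alg) where
  /-- the underlying map -/
  toFun : A → B → C
  map_left : ∀ {n} (f : V.lang.Functions n) (a : Fin n → A) (b : B),
    toFun (funMap f a) b = funMap f (fun i => toFun (a i) b)
  map_right : ∀ {n} (f : V.lang.Functions n) (a : A) (b : Fin n → B),
    toFun a (funMap f b) = funMap f (fun i => toFun a (b i))

/-- The relations that make `A × B → A ⊗ B` a bihomomorphism. -/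
inductive TensorRel (A B : V.Alg) : V.lang.Term (A × B) → V.lang.Term (A × B) → Prop
  | left {n} (f : V.lang.Functions n) (a : Fin n → A) (b : B) :
      TensorRel A B (Term.var (funMap f a, b)) (Term.func f fun i => Term.var (a i, b))
  | right {n} (f : V.lang.Functions n) (a : A) (b : Fin n → B) :
      TensorRel A B (Term.var (a, funMap f b)) (Term.func f fun i => Term.var (a, b i))

/-- The tensor product of two algebras. -/
noncomputable def tensor (A B : V.Alg) : V.Alg := presented (TensorRel A B)

/-- The pure tensor `a ⊗ b`. -/
def tmul {A B : V.Alg} (a : A) (b : B) : tensor A B := presented.gen (a, b)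

lemma tmul_op_left {A B : V.Alg} {n : ℕ} (f : V.lang.Functions n) (a : Fin n → A) (b : B) :
    tmul (funMap f a) b = funMap f (fun i => tmul (a i) b) :=
  presented.rel_gen (TensorRel.left f a b)

lemma tmul_op_right {A B : V.Alg} {n : ℕ} (f : V.lang.Functions n) (a : A) (b : Fin n → B) :
    tmul a (funMap f b) = funMap f (fun i => tmul a (b i)) :=
  presented.rel_gen (TensorRel.right f a b)

/-- The morphism `A ⊗ B ⟶ C` that corresponds to a bihomomorphism. -/
noncomputable def tdesc {A B C : V.Alg} (φ : BiHom A B C) : tensor A B ⟶ C :=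
  presented.desc (fun p => φ.toFun p.1 p.2) (by
    rintro _ _ (⟨f, a, b⟩ | ⟨f, a, b⟩)
    · exact φ.map_left f a b
    · exact φ.map_right f a b)

@[simp] lemma tdesc_tmul {A B C : V.Alg} (φ : BiHom A B C) (a : A) (b : B) :
    tdesc φ (tmul a b) = φ.toFun a b := rfl

lemma tensor_ext {A B C : V.Alg} {f g : tensor A B ⟶ C}
    (h : ∀ a b, f (tmul a b) = g (tmul a b)) : f = g :=
  presented.hom_ext fun p => h p.1 p.2

/-- The universal property of the tensor product: morphisms `A ⊗ B ⟶ C` are the same as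
bihomomorphisms `A × B → C`. -/
noncomputable def tensorHomEquiv (A B C : V.Alg) : (tensor A B ⟶ C) ≃ BiHom A B C where
  toFun g :=
    { toFun := fun a b => g (tmul a b)
      map_left := fun f a b => by rw [tmul_op_left, map_op]
      map_right := fun f a b => by rw [tmul_op_right, map_op] }
  invFun := tdesc
  left_inv _ := tensor_ext fun _ _ => rfl
  right_inv _ := rfl

/-- `a ↦ a ⊗ b` as a morphism. -/
noncomputable def tmulR {A B : V.Alg} (b : B) : A ⟶ tensor A B :=
  homMk (fun a => tmul a b) fun f a => tmul_op_left f a b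

/-- `b ↦ a ⊗ b` as a morphism. -/
noncomputable def tmulL {A B : V.Alg} (a : A) : B ⟶ tensor A B :=
  homMk (fun b => tmul a b) fun f b => tmul_op_right f a b

lemma tensor_ext_left {A B C D : V.Alg} {f g : tensor (tensor A B) C ⟶ D}
    (h : ∀ a b c, f (tmul (tmul a b) c) = g (tmul (tmul a b) c)) : f = g :=
  tensor_ext fun s c => by
    have : tmulR c ≫ f = tmulR c ≫ g := tensor_ext fun a b => h a b c
    exact ConcreteCategory.congr_hom this s

lemma tensor_ext_right {A B C D : V.Alg} {f g : tensor A (tensor B C) ⟶ D}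
    (h : ∀ a b c, f (tmul a (tmul b c)) = g (tmul a (tmul b c))) : f = g :=
  tensor_ext fun a s => by
    have : tmulL a ≫ f = tmulL a ≫ g := tensor_ext fun b c => h a b c
    exact ConcreteCategory.congr_hom this s

lemma tensor_ext_left₄ {A B C D E : V.Alg} {f g : tensor (tensor (tensor A B) C) D ⟶ E}
    (h : ∀ a b c d, f (tmul (tmul (tmul a b) c) d) = g (tmul (tmul (tmul a b) c) d)) : f = g :=
  tensor_ext fun s d => by
    have : tmulR d ≫ f = tmulR d ≫ g := tensor_ext_left fun a b c => h a b c d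
    exact ConcreteCategory.congr_hom this s

/-- The tensor product of two morphisms. -/
noncomputable def tmap {A B C D : V.Alg} (f : A ⟶ C) (g : B ⟶ D) : tensor A B ⟶ tensor C D :=
  tdesc
    { toFun := fun a b => tmul (f a) (g b)
      map_left := fun o a b => by rw [map_op, tmul_op_left]
      map_right := fun o a b => by rw [map_op, tmul_op_right] }

/-- The symmetry `A ⊗ B ⟶ B ⊗ A`, `a ⊗ b ↦ b ⊗ a`. -/
noncomputable def tswap (A B : V.Alg) : tensor A B ⟶ tensor B A :=
  tdesc
    { toFun := fun a b => tmul b a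
      map_left := fun o a b => tmul_op_right o b a
      map_right := fun o a b => tmul_op_left o b a }

/-- The unit object, the free algebra on a one-element set. -/
noncomputable abbrev tunit (V : AlgVariety.{u}) : V.Alg := (free V).obj PUnit

lemma unit_tensor_ext {A B : V.Alg} {f g : tensor (tunit V) A ⟶ B}
    (h : ∀ a, f (tmul (freeι PUnit.unit) a) = g (tmul (freeι PUnit.unit) a)) : f = g :=
  tensor_ext fun s a => by
    have : tmulR a ≫ f = tmulR a ≫ g := free_ext fun _ => h a
    exact ConcreteCategory.congr_hom this s

lemma tensor_unit_ext {A B : V.Alg} {f g : tensor A (tunit V) ⟶ B}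
    (h : ∀ a, f (tmul a (freeι PUnit.unit)) = g (tmul a (freeι PUnit.unit))) : f = g :=
  tensor_ext fun a s => by
    have : tmulL a ≫ f = tmulL a ≫ g := free_ext fun _ => h a
    exact ConcreteCategory.congr_hom this s

lemma tensor_unit_tensor_ext {A B C : V.Alg} {f g : tensor (tensor A (tunit V)) B ⟶ C}
    (h : ∀ a b, f (tmul (tmul a (freeι PUnit.unit)) b) = g (tmul (tmul a (freeι PUnit.unit)) b)) :
    f = g :=
  tensor_ext fun s b => by
    have : tmulR b ≫ f = tmulR b ≫ g := tensor_unit_ext fun a => h a b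
    exact ConcreteCategory.congr_hom this s

section Commutative

variable [V.IsCommutative]

/-- In a commutative variety, an operation applied pointwise to morphisms is a morphism. -/
def opHom {A B : V.Alg} {n : ℕ} (f : V.lang.Functions n) (x : Fin n → (A ⟶ B)) : A ⟶ B :=
  homMk (fun a => funMap f fun i => x i a) fun g a => by
    simp only [map_op]
    exact op_comm B f g fun i j => x i (a j)

/-- The morphism `A ⊗ B ⟶ C` that corresponds to a family of morphisms `A ⟶ C`, compatible with the
operations in `B`. -/
noncomputable def tdescL {A B C : V.Alg} (φ : B → (A ⟶ C))
    (h : ∀ {n} (f : V.lang.Functions n) (b : Fin n → B),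
      φ (funMap f b) = opHom f (fun i => φ (b i))) : tensor A B ⟶ C :=
  tdesc
    { toFun := fun a b => φ b a
      map_left := fun f a b => map_op (φ b) f a
      map_right := fun f a b => ConcreteCategory.congr_hom (h f b) a }

/-- The associator `(a ⊗ b) ⊗ c ↦ a ⊗ (b ⊗ c)`. -/
noncomputable def tassoc (A B C : V.Alg) : tensor (tensor A B) C ⟶ tensor A (tensor B C) :=
  tdescL
    (fun c => tdesc
      { toFun := fun a b => tmul a (tmul b c)
        map_left := fun f a b => tmul_op_left f a _
        map_right := fun f a b => by rw [tmul_op_left, tmul_op_right] })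
    (fun f c => tensor_ext fun a b => by
      change tmul a (tmul b (funMap f c)) = funMap f (fun i => tmul a (tmul b (c i)))
      rw [tmul_op_right, tmul_op_right])

/-- The inverse associator `a ⊗ (b ⊗ c) ↦ (a ⊗ b) ⊗ c`. -/
noncomputable def tassocInv (A B C : V.Alg) : tensor A (tensor B C) ⟶ tensor (tensor A B) C :=
  tswap _ _ ≫ tdescL
    (fun a => tdesc
      { toFun := fun b c => tmul (tmul a b) c
        map_left := fun f b c => by rw [tmul_op_right, tmul_op_left]
        map_right := fun f b c => tmul_op_right f _ c })
    (fun f a => tensor_ext fun b c => by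
      change tmul (tmul (funMap f a) b) c = funMap f (fun i => tmul (tmul (a i) b) c)
      rw [tmul_op_left, tmul_op_left])

/-- The left unitor `* ⊗ a ↦ a`. -/
noncomputable def tleft (A : V.Alg) : tensor (tunit V) A ⟶ A :=
  tdescL (fun a => freeDesc (fun _ => a)) (fun _ _ => free_ext fun _ => rfl)

noncomputable instance : MonoidalCategoryStruct V.Alg where
  tensorObj := tensor
  tensorUnit := tunit V
  tensorHom := tmap
  whiskerLeft A _ _ f := tmap (𝟙 A) f
  whiskerRight f A := tmap f (𝟙 A)
  associator A B C :=
    { hom := tassoc A B C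
      inv := tassocInv A B C
      hom_inv_id := tensor_ext_left fun _ _ _ => rfl
      inv_hom_id := tensor_ext_right fun _ _ _ => rfl }
  leftUnitor A :=
    { hom := tleft A
      inv := tmulL (freeι PUnit.unit)
      hom_inv_id := unit_tensor_ext fun _ => rfl
      inv_hom_id := rfl }
  rightUnitor A :=
    { hom := tswap _ _ ≫ tleft A
      inv := tmulR (freeι PUnit.unit)
      hom_inv_id := tensor_unit_ext fun _ => rfl
      inv_hom_id := rfl }

/-- The monoidal structure on a commutative variety. -/
noncomputable instance : MonoidalCategory V.Alg :=
  MonoidalCategory.ofTensorHom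
    (id_tensorHom_id := fun _ _ => tensor_ext fun _ _ => rfl)
    (id_tensorHom := fun _ _ _ _ => rfl)
    (tensorHom_id := fun _ _ => rfl)
    (tensorHom_comp_tensorHom := fun _ _ _ _ => tensor_ext fun _ _ => rfl)
    (associator_naturality := fun _ _ _ => tensor_ext_left fun _ _ _ => rfl)
    (leftUnitor_naturality := fun _ => unit_tensor_ext fun _ => rfl)
    (rightUnitor_naturality := fun _ => tensor_unit_ext fun _ => rfl)
    (pentagon := fun _ _ _ _ => tensor_ext_left₄ fun _ _ _ _ => rfl)
    (triangle := fun _ _ => tensor_unit_tensor_ext fun _ _ => rfl)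

/-- The symmetric monoidal structure on a commutative variety. -/
noncomputable instance : SymmetricCategory V.Alg where
  braiding A B :=
    { hom := tswap A B
      inv := tswap B A
      hom_inv_id := tensor_ext fun _ _ => rfl
      inv_hom_id := tensor_ext fun _ _ => rfl }
  braiding_naturality_right _ _ _ _ := tensor_ext fun _ _ => rfl
  braiding_naturality_left _ _ := tensor_ext fun _ _ => rfl
  hexagon_forward _ _ _ := tensor_ext_left fun _ _ _ => rfl
  hexagon_reverse _ _ _ := tensor_ext_right fun _ _ _ => rfl
  symmetry _ _ := tensor_ext fun _ _ => rfl

end Commutative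

end AlgVariety

namespace AlgVariety

/-! ### Comparison maps between `F(S) ⊗ F(T)` and `F(S × T)`. -/

variable {V : AlgVariety.{u}}

/-! Morphisms out of `F(S) ⊗ F(T)` are bihomomorphisms on `F(S) × F(T)`. Extending freely in one
variable and then in the other identifies these with arbitrary maps on `S × T`, which is the
universal property of `F(S × T)`. Existence of the extension is where commutativity enters:
operations applied pointwise to morphisms must again give morphisms (`opHom`). Uniqueness
(`free_tensor_ext`) holds in every variety.

Uniqueness also yields all coherence. Two morphisms out of an iterated tensor product of free
algebras agree once they agree on pure tensors of generators. There, each structure map only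
rebrackets, swaps or drops entries of a tuple, so both sides of every axiom give the same generator.
-/

/-- The comparison map `F(S) ⊗ F(T) ⟶ F(S × T)`, `s ⊗ t ↦ (s, t)`. -/
noncomputable def freeTensorHom [V.IsCommutative] (S T : Type u) :
    tensor (freeObj V S) (freeObj V T) ⟶ freeObj V (S × T) :=
  -- For each generator `s`, the map `t ↦ (s, t)` extends to `h_s : F(T) ⟶ F(S × T)`; for fixed `b`,
  -- the map `s ↦ h_s b` then extends over `F(S)`. Compatibility with an operation in `b` compares
  -- two morphisms out of `F(S)`, the second formed by `opHom`, so it suffices to check it at each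
  -- `s`, where it says that `h_s` is a morphism.
  tdescL (fun b => freeDesc (fun s => (freeDesc (fun t => freeι (s, t)) : freeObj V T ⟶ _) b))
    (fun f b => free_ext fun s =>
      map_op (freeDesc (fun t => freeι (s, t)) : freeObj V T ⟶ freeObj V (S × T)) f b)

/-- The inverse comparison map `F(S × T) ⟶ F(S) ⊗ F(T)`, `(s, t) ↦ s ⊗ t`. -/
noncomputable def freeTensorInv (S T : Type u) :
    freeObj V (S × T) ⟶ tensor (freeObj V S) (freeObj V T) :=
  freeDesc (fun p => tmul (freeι p.1) (freeι p.2))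

/-! ### Extensionality on generators. -/

lemma free_tensor_ext {S T : Type u} {A : V.Alg}
    {f g : tensor (freeObj V S) (freeObj V T) ⟶ A}
    (h : ∀ s t, f (tmul (freeι s) (freeι t)) = g (tmul (freeι s) (freeι t))) : f = g :=
  tensor_ext fun x y => by
    -- One variable is freed at a time: with a generator fixed on the left, freeness of `F(T)` gives
    -- agreement at every `y`; with that `y` fixed, freeness of `F(S)` does the rest.
    have e (s : S) : tmulL (freeι s) ≫ f = tmulL (freeι s) ≫ g := free_ext fun t => h s t
    have : tmulR y ≫ f = tmulR y ≫ g := free_ext fun s => ConcreteCategory.congr_hom (e s) y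
    exact ConcreteCategory.congr_hom this x

/-- This is the form needed for associativity. It frees the last factor first and then applies the
two-factor case to the pair on the left. -/
lemma free_tensor_ext₃ {S T U : Type u} {A : V.Alg}
    {f g : tensor (tensor (freeObj V S) (freeObj V T)) (freeObj V U) ⟶ A}
    (h : ∀ s t u, f (tmul (tmul (freeι s) (freeι t)) (freeι u)) =
      g (tmul (tmul (freeι s) (freeι t)) (freeι u))) : f = g :=
  tensor_ext fun x y => by
    have e (s : S) (t : T) : tmulL (tmul (freeι s) (freeι t)) ≫ f =
        tmulL (tmul (freeι s) (freeι t)) ≫ g := free_ext fun u => h s t u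
    have : tmulR y ≫ f = tmulR y ≫ g :=
      free_tensor_ext fun s t => ConcreteCategory.congr_hom (e s t) y
    exact ConcreteCategory.congr_hom this x

/-! ### The monoidal isomorphisms, their coherence and the symmetry. -/

variable [V.IsCommutative]

/-- The free functor sends products of sets to tensor products. -/
noncomputable def freeTensorIso (S T : Type u) :
    tensor (freeObj V S) (freeObj V T) ≅ freeObj V (S × T) where
  hom := freeTensorHom S T
  inv := freeTensorInv S T
  hom_inv_id := free_tensor_ext fun _ _ => rfl
  inv_hom_id := free_ext fun p => by
    -- The round trip splits `p` into its components and pairs them again, so eta for pairs closes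
    -- the goal.
    change freeι (p.1, p.2) = freeι p
    rfl

/-- The strong monoidal structure of the free functor. -/
noncomputable def freeCoreMonoidal (V : AlgVariety.{u}) [V.IsCommutative] :
    (free V).CoreMonoidal where
  -- The tensor unit is by definition the free algebra on `PUnit`, the unit object of sets.
  εIso := Iso.refl _
  μIso S T := freeTensorIso S T
  μIso_hom_natural_left _ _ := free_tensor_ext fun _ _ => rfl
  μIso_hom_natural_right _ _ := free_tensor_ext fun _ _ => rfl
  associativity _ _ _ := free_tensor_ext₃ fun _ _ _ => rfl
  -- The unit is itself free, so the unit axioms can also be tested on generators of both factors.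
  left_unitality _ := free_tensor_ext fun _ _ => rfl
  right_unitality _ := free_tensor_ext fun s t => by
    change freeι s = freeι _
    rfl

end AlgVariety

open AlgVariety in
theorem mainTheorem7 (V : AlgVariety.{u}) [V.IsCommutative] :
    Nonempty (AlgVariety.free V).Braided := by
  let _ := (freeCoreMonoidal V).toMonoidal
  refine ⟨{ braided := fun S T => free_tensor_ext fun s t => ?_ }⟩
  -- Both composites send `s ⊗ t` to the generator `(t, s)`: one swaps the pair after the comparison
  -- map, the other swaps the tensor factors before it.
  change freeι _ = freeι (t, s)
  rfl
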